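/- Conventions. The epicyclic category $\tilde\Lambda$ has objects $n\ge 0$; a morphism $n\to m$ is a class of non-decreasing maps $\varphi:\mathbb Z\to\mathbb Z$ with $\varphi(x+n+1)=\varphi(x)+d(m+1)$ for some integer $d\ge 1$, modulo $\varphi\sim\varphi+k(m+1)$, $k\in\mathbb Z$; one sets $\mathrm{Mod}(\varphi)=d$. The cyclic category $\Lambda\subset\tilde\Lambda$ has the same objects and the morphisms with $\mathrm{Mod}=1$. Let $\mathrm{Id}_n^{u}: u(n+1)-1\to n$ be the morphism of $\tilde\Lambda$, with $\mathrm{Mod}=u$, given by the identity of $\mathbb Z$. The category $\mathcal{RF}$ has objects the integers $a>0$, morphisms $f_{r,s}:a\to b$ for $a=rbs$, and composition $f_{r,s}\circ f_{p,q}=f_{rp,sq}$; put $\mathrm{Fr}(f_{r,s})=s$. The pericyclic category $\Pi$ is the subcategory of $\tilde\Lambda^{\rm op}\times\mathcal{RF}$ with the same objects $(n,a)$ and with morphisms the pairs $(h,f)$ such that $\mathrm{Fr}(f)=\mathrm{Mod}(h)$; let $\lambda:\Pi\to\tilde\Lambda^{\rm op}$ be the projection. A pointed cyclic set is a functor $Y$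 from $\Lambda^{\rm op}$ to pointed sets. For $a\ge1$ let $\mathrm{sd}_a(Y)(n)=Y(a(n+1)-1)$, on which the cyclic group $C_a$ acts through the translations of $\mathbb Z$ by multiples of $n+1$; the fixed points $\mathrm{sd}_a(Y)^{C_a}$ form a pointed cyclic set, in which the class of $\varphi$ acts through the same map $\varphi$, viewed as periodic for the periods multiplied by $a$. An epicyclic space $(Y,\phi)$ (in the sense of Dundas–Goodwillie–McCarthy) is a pointed cyclic set $Y$ with pointed cyclic maps $\phi_q:\mathrm{sd}_q(Y)^{C_q}\to Y$, $q\ge1$, such that $\phi_1=\mathrm{Id}$ and $\phi_k\circ \mathrm{sd}_k(\phi_r)=\phi_{kr}$ on $\mathrm{sd}_k(\mathrm{sd}_r(Y)^{C_r})^{C_k}=\mathrm{sd}_{kr}(Y)^{C_{kr}}$ for all $k,r\ge1$. Statement. (1) Let $(Y,\phi)$ be an epicyclic space. There is a unique covariant functor $\beta:\Pi\to\mathfrak{Sets}$ with $\beta(n,a)=\mathrm{sd}_a(Y)^{C_a}(n)$ on objects and with the following values on morphisms: - $\beta(\ell,\mathrm{Id}_a)=\mathrm{sd}_a(Y)^{C_a}(\ell)$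 for $\ell\in\mathrm{Hom}_{\Lambda^{\rm op}}(n,m)$; - for $\chi(n,u,v)=(\mathrm{Id}_n^{u,{\rm op}},f_{1,u}):(n,uv)\to(u(n+1)-1,v)$, the map $\beta(\chi(n,u,v))$ is the inclusion of fixed points $\mathrm{sd}_{uv}(Y)^{C_{uv}}(n)\subset\mathrm{sd}_v(Y)^{C_v}(u(n+1)-1)$ inside $Y(uv(n+1)-1)$; - $\beta(\mathrm{Id}_n,f_{q,1}):\mathrm{sd}_{qa}(Y)^{C_{qa}}(n)\to\mathrm{sd}_a(Y)^{C_a}(n)$ is the map induced by $\phi_q$, that is, $\mathrm{sd}_a(\phi_q)$ on $\mathrm{sd}_{qa}(Y)^{C_{qa}}=\mathrm{sd}_a(\mathrm{sd}_q(Y)^{C_q})^{C_a}$. All the maps $\beta(f)$ preserve the base points. (2) $\beta$ encodes $(Y,\phi)$ faithfully: for epicyclic spaces $(Y,\phi)$ and $(Y',\phi')$ with associated functors $\beta$ and $\beta'$, restriction of $g$ to the sets $\mathrm{sd}_a(Y)^{C_a}(n)\subset Y(a(n+1)-1)$ defines a bijection from the maps of cyclic sets $g:Y\to Y'$ which commute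 with all $\phi_q,\phi'_q$ (base points not being required to be preserved) onto the natural transformations $\beta\to\beta'$. Moreover $g$ preserves base points if and only if the corresponding natural transformation does. (3) Thus $\Pi$ carries both notions of epicyclic space, the epicyclic sets in the other sense being the functors $\tilde\Lambda^{\rm op}\to\mathfrak{Sets}$: composition with $\lambda$ is a fully faithful functor from the category of functors $\tilde\Lambda^{\rm op}\to\mathfrak{Sets}$ to the category of functors $\Pi\to\mathfrak{Sets}$, and its essential image consists of the functors which map all the morphisms $(\mathrm{Id}_n,f_{q,1}):(n,qa)\to(n,a)$ to bijections. -/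

import Mathlib

open CategoryTheory Opposite

universe u

namespace Pericyclic

noncomputable section

/-! ## The epicyclic category `Λ̃` and the cyclic category `Λ` -/

/-- Objects of the epicyclic category: `⟨n⟩` with `n ≥ 0` is the object with `n + 1` points. -/
structure EpiCat : Type where
  dim : ℕ

/-- The period `n + 1` of the object `n`. -/
def EpiCat.per (n : EpiCat) : ℤ := (n.dim : ℤ) + 1

/-- Non-decreasing maps `φ : ℤ → ℤ` with `φ (x + (n + 1)) = φ x + d (m + 1)`, `d ≥ 1`. -/
structure PeriodicMap (n m : EpiCat) : Type where
  toFun : ℤ → ℤ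
  deg : ℕ+
  mono : Monotone toFun
  shift : ∀ x, toFun (x + n.per) = toFun x + (deg : ℤ) * m.per

namespace PeriodicMap

variable {n m p : EpiCat}

theorem shift_mul (f : PeriodicMap n m) (x k : ℤ) :
    f.toFun (x + k * n.per) = f.toFun x + k * (f.deg : ℤ) * m.per := by
  induction k using Int.induction_on with
  | zero => simp
  | succ i ih =>
    have h := f.shift (x + (i : ℤ) * n.per)
    rw [ih] at h
    rw [show x + ((i : ℤ) + 1) * n.per = x + (i : ℤ) * n.per + n.per by ring, h]
    ring
  | pred i ih =>
    have h := f.shift (x + (-(i : ℤ) - 1) * n.per)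
    rw [show x + (-(i : ℤ) - 1) * n.per + n.per = x + -(i : ℤ) * n.per by ring, ih] at h
    linear_combination -h

/-- Equivalence: `φ' = φ + k (m + 1)` for some integer `k`. -/
instance setoid (n m : EpiCat) : Setoid (PeriodicMap n m) where
  r f g := ∃ k : ℤ, ∀ x, g.toFun x = f.toFun x + k * m.per
  iseqv :=
    { refl := fun f => ⟨0, fun x => by ring⟩
      symm := by
        rintro f g ⟨k, h⟩
        exact ⟨-k, fun x => by rw [h x]; ring⟩
      trans := by
        rintro f g e ⟨k, h⟩ ⟨l, h'⟩
        exact ⟨k + l, fun x => by rw [h' x, h x]; ring⟩ }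

def id (n : EpiCat) : PeriodicMap n n where
  toFun x := x
  deg := 1
  mono := monotone_id
  shift x := by simp

/-- Composition: first `f`, then `g`. -/
def comp (f : PeriodicMap n m) (g : PeriodicMap m p) : PeriodicMap n p where
  toFun x := g.toFun (f.toFun x)
  deg := f.deg * g.deg
  mono := g.mono.comp f.mono
  shift x := by rw [f.shift, g.shift_mul]; push_cast; ring

theorem per_pos (n : EpiCat) : 0 < n.per := by
  unfold EpiCat.per; positivity

theorem deg_eq_of_equiv {f g : PeriodicMap n m} (h : f ≈ g) : f.deg = g.deg := by
  obtain ⟨k, h⟩ := h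
  have h0 := h 0
  have h1 := h (0 + n.per)
  rw [f.shift, g.shift, h0] at h1
  have h2 : ((f.deg : ℤ) - g.deg) * m.per = 0 := by linear_combination -h1
  rcases mul_eq_zero.mp h2 with h3 | h3
  · exact PNat.coe_injective (by exact_mod_cast sub_eq_zero.mp h3)
  · exact absurd h3 (per_pos m).ne'

theorem comp_equiv {f f' : PeriodicMap n m} {g g' : PeriodicMap m p} (hf : f ≈ f')
    (hg : g ≈ g') : f.comp g ≈ f'.comp g' := by
  obtain ⟨k, hf⟩ := hf
  obtain ⟨l, hg⟩ := hg
  refine ⟨k * g.deg + l, fun x => ?_⟩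
  change g'.toFun (f'.toFun x) = g.toFun (f.toFun x) + _
  rw [hg, hf, g.shift_mul]
  ring

end PeriodicMap

/-- The epicyclic category `Λ̃`. -/
instance : Category EpiCat where
  Hom n m := Quotient (PeriodicMap.setoid n m)
  id n := ⟦PeriodicMap.id n⟧
  comp f g := Quotient.map₂ PeriodicMap.comp
    (fun _ _ hf _ _ hg => PeriodicMap.comp_equiv hf hg) f g
  id_comp f := by
    induction f using Quotient.inductionOn
    exact Quotient.sound ⟨0, fun x => by simp [PeriodicMap.comp, PeriodicMap.id]⟩
  comp_id f := by
    induction f using Quotient.inductionOn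
    exact Quotient.sound ⟨0, fun x => by simp [PeriodicMap.comp, PeriodicMap.id]⟩
  assoc f g h := by
    induction f using Quotient.inductionOn
    induction g using Quotient.inductionOn
    induction h using Quotient.inductionOn
    exact Quotient.sound ⟨0, fun x => by simp [PeriodicMap.comp]⟩

/-- The morphism of `Λ̃` represented by a periodic map. -/
def PeriodicMap.cls {n m : EpiCat} (f : PeriodicMap n m) : n ⟶ m := Quotient.mk _ f

/-- The degree `Mod : Λ̃ ⟶ ℕ^×`. -/
def Mod {n m : EpiCat} (f : n ⟶ m) : ℕ+ :=
  Quotient.lift PeriodicMap.deg (fun _ _ h => PeriodicMap.deg_eq_of_equiv h) f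

theorem Mod_id (n : EpiCat) : Mod (𝟙 n) = 1 := rfl

theorem Mod_comp {n m p : EpiCat} (f : n ⟶ m) (g : m ⟶ p) :
    Mod (f ≫ g) = Mod f * Mod g := by
  induction f using Quotient.inductionOn
  induction g using Quotient.inductionOn
  rfl

/-- The morphisms of `Λ̃` of degree one. -/
def modOne : MorphismProperty EpiCat := fun _ _ f => Mod f = 1

instance : modOne.IsMultiplicative where
  id_mem n := Mod_id n
  comp_mem f g hf hg := by
    change Mod _ = 1
    rw [Mod_comp, show Mod f = 1 from hf, show Mod g = 1 from hg, one_mul]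

/-- The cyclic category `Λ`: the subcategory of `Λ̃` with the same objects and the morphisms of
degree one. -/
abbrev Cyc : Type := WideSubcategory modOne

/-- The morphism of `Λ` represented by a periodic map of degree one. -/
def PeriodicMap.cyc {n m : Cyc} (f : PeriodicMap n.obj m.obj) (h : f.deg = 1) : n ⟶ m :=
  ⟨f.cls, h⟩

/-- A periodic map representing a morphism of `Λ`. -/
def lift {n m : Cyc} (f : n ⟶ m) : PeriodicMap n.obj m.obj :=
  Quotient.out (s := PeriodicMap.setoid n.obj m.obj) f.hom

theorem lift_cls {n m : Cyc} (f : n ⟶ m) : (lift f).cls = f.hom :=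
  Quotient.out_eq (s := PeriodicMap.setoid n.obj m.obj) f.hom

theorem lift_deg {n m : Cyc} (f : n ⟶ m) : (lift f).deg = 1 := by
  have h : Mod (lift f).cls = 1 := by rw [lift_cls]; exact f.property
  exact h

theorem cyc_eq {n m : Cyc} {f g : PeriodicMap n.obj m.obj} {hf : f.deg = 1} {hg : g.deg = 1}
    (h : ∃ k : ℤ, ∀ x, g.toFun x = f.toFun x + k * m.obj.per) : f.cyc hf = g.cyc hg :=
  WideSubcategory.hom_ext _ (Quotient.sound h)

theorem lift_cyc {n m : Cyc} (f : PeriodicMap n.obj m.obj) (hf : f.deg = 1) :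
    ∃ k : ℤ, ∀ x, (lift (f.cyc hf)).toFun x = f.toFun x + k * m.obj.per :=
  Quotient.exact (lift_cls (f.cyc hf)).symm

/-! ## Edgewise subdivision and fixed points -/

/-- The object `a (n + 1) - 1`, the concatenation of `a` copies of `n`. -/
def EpiCat.sd (a : ℕ+) (n : EpiCat) : EpiCat := ⟨(a : ℕ) * (n.dim + 1) - 1⟩

abbrev sdObj (a : ℕ+) (n : Cyc) : Cyc := ⟨n.obj.sd a⟩

theorem per_sd (a : ℕ+) (n : EpiCat) : (n.sd a).per = (a : ℤ) * n.per := by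
  have h : 1 ≤ (a : ℕ) * (n.dim + 1) := Nat.mul_pos a.pos (Nat.succ_pos _)
  simp only [EpiCat.sd, EpiCat.per]
  push_cast [Nat.cast_sub h]
  ring

/-- The edgewise subdivision `sd^a` on representatives: the same map of `ℤ`, viewed as periodic for
the periods multiplied by `a`. On a map of `Δ` this is the concatenation of `a` copies. -/
def PeriodicMap.sd (a : ℕ+) {n m : EpiCat} (f : PeriodicMap n m) :
    PeriodicMap (n.sd a) (m.sd a) where
  toFun := f.toFun
  deg := f.deg
  mono := f.mono
  shift x := by rw [per_sd, per_sd, f.shift_mul]; ring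

/-- The translation by `k (n + 1)` on the object `a (n + 1) - 1`. For `k` in `ℤ` these are the
elements of the cyclic group `C_a ⊂ Aut_Λ (a (n + 1) - 1)`. -/
def rot (a : ℕ+) (n : EpiCat) (k : ℤ) : PeriodicMap (n.sd a) (n.sd a) where
  toFun x := x + k * n.per
  deg := 1
  mono := fun _ _ h => by simpa using h
  shift x := by simp; ring

/-- The identity of `ℤ` as an isomorphism between objects with the same number of points. -/
def sameHom {n m : Cyc} (h : n.obj.per = m.obj.per) : n ⟶ m :=
  PeriodicMap.cyc
    { toFun := fun x => x, deg := 1, mono := monotone_id, shift := fun x => by simp [h] } rfl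

/-- Pointed cyclic sets. -/
abbrev PCyc : Type (u + 1) := Cycᵒᵖ ⥤ Pointed.{u}

/-- `Y(f) : Y(m) → Y(n)` for `f : n ⟶ m` in `Λ`. -/
def PCyc.act (Y : PCyc.{u}) {n m : Cyc} (f : n ⟶ m) : (Y.obj (op m)).X → (Y.obj (op n)).X :=
  (Y.map f.op).toFun

theorem PCyc.act_id (Y : PCyc.{u}) (n : Cyc) (y : (Y.obj (op n)).X) : Y.act (𝟙 n) y = y := by
  simp [PCyc.act]

theorem PCyc.act_act (Y : PCyc.{u}) {n m p : Cyc} (f : n ⟶ m) (g : m ⟶ p)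
    (y : (Y.obj (op p)).X) : Y.act f (Y.act g y) = Y.act (f ≫ g) y := by
  simp [PCyc.act]

theorem PCyc.act_point (Y : PCyc.{u}) {n m : Cyc} (f : n ⟶ m) :
    Y.act f (Y.obj (op m)).point = (Y.obj (op n)).point := (Y.map f.op).map_point

theorem PCyc.act_nat {Y Z : PCyc.{u}} (g : Y ⟶ Z) {n m : Cyc} (f : n ⟶ m)
    (y : (Y.obj (op m)).X) :
    (g.app (op n)).toFun (Y.act f y) = Z.act f ((g.app (op m)).toFun y) :=
  congrFun (congrArg Pointed.Hom.toFun (g.naturality f.op)) y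

/-- `y ∈ sd_a(Y)(n) = Y(a (n + 1) - 1)` is fixed by `C_a`. -/
def IsFix (Y : PCyc.{u}) (a : ℕ+) (n : Cyc) (y : (Y.obj (op (sdObj a n))).X) : Prop :=
  ∀ k : ℤ, Y.act (PeriodicMap.cyc (n := sdObj a n) (m := sdObj a n) (rot a n.obj k) rfl) y = y

/-- The action on `sd_a(Y)` of a representative of a morphism of `Λ`. -/
def sdAct (Y : PCyc.{u}) (a : ℕ+) {n m : Cyc} (f : PeriodicMap n.obj m.obj) (hf : f.deg = 1) :
    (Y.obj (op (sdObj a m))).X → (Y.obj (op (sdObj a n))).X :=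
  Y.act (PeriodicMap.cyc (n := sdObj a n) (m := sdObj a m) (f.sd a) hf)

theorem IsFix.sdAct {Y : PCyc.{u}} {a : ℕ+} {n m : Cyc} (f : PeriodicMap n.obj m.obj)
    (hf : f.deg = 1) {y : (Y.obj (op (sdObj a m))).X} (hy : IsFix Y a m y) :
    IsFix Y a n (sdAct Y a f hf y) := by
  intro k
  conv_rhs => rw [← hy k]
  unfold Pericyclic.sdAct
  rw [PCyc.act_act, PCyc.act_act]
  congr 1
  refine cyc_eq ⟨0, fun x => ?_⟩
  change f.toFun x + k * m.obj.per = f.toFun (x + k * n.obj.per) + 0 * _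
  rw [f.shift_mul, hf]
  simp

/-- On fixed points the action of a representative depends only on the morphism of `Λ`. -/
theorem sdAct_congr {Y : PCyc.{u}} {a : ℕ+} {n m : Cyc} {f g : PeriodicMap n.obj m.obj}
    {hf : f.deg = 1} {hg : g.deg = 1} (h : ∃ k : ℤ, ∀ x, g.toFun x = f.toFun x + k * m.obj.per)
    {y : (Y.obj (op (sdObj a m))).X} (hy : IsFix Y a m y) :
    sdAct Y a f hf y = sdAct Y a g hg y := by
  obtain ⟨k, h⟩ := h
  conv_lhs => rw [← hy k]
  unfold sdAct
  rw [PCyc.act_act]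
  congr 1
  refine cyc_eq ⟨0, fun x => ?_⟩
  change g.toFun x = f.toFun x + k * m.obj.per + 0 * _
  rw [h]; ring

theorem sdAct_id {Y : PCyc.{u}} {a : ℕ+} {n : Cyc} (y : (Y.obj (op (sdObj a n))).X) :
    sdAct Y a (n := n) (PeriodicMap.id n.obj) rfl y = y :=
  Y.act_id (sdObj a n) y

theorem sdAct_comp {Y : PCyc.{u}} {a : ℕ+} {n m p : Cyc} (f : PeriodicMap n.obj m.obj)
    (g : PeriodicMap m.obj p.obj) (hf : f.deg = 1) (hg : g.deg = 1)
    (y : (Y.obj (op (sdObj a p))).X) :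
    sdAct Y a f hf (sdAct Y a g hg y) =
      sdAct Y a (f.comp g) (by simp [PeriodicMap.comp, hf, hg]) y := by
  unfold sdAct
  rw [PCyc.act_act]
  rfl

/-- The fixed points `sd_a(Y)^{C_a}` as a pointed cyclic set: its value at `n` is the set of points
of `sd_a(Y)(n) = Y(a (n + 1) - 1)` fixed by `C_a`, and `f` in `Λ` acts by the subdivision `sd^a` of
a representative of `f`. -/
def sdFixObj (a : ℕ+) (Y : PCyc.{u}) : PCyc.{u} where
  obj n := ⟨{y : (Y.obj (op (sdObj a n.unop))).X // IsFix Y a n.unop y},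
    ⟨(Y.obj (op (sdObj a n.unop))).point, fun _ => Y.act_point _⟩⟩
  map {m n} f :=
    { toFun := fun y => ⟨sdAct Y a (lift f.unop) (lift_deg _) y.1, y.2.sdAct _ _⟩
      map_point := Subtype.ext (Y.act_point _) }
  map_id n := by
    refine Pointed.Hom.ext (funext fun y => Subtype.ext ?_)
    refine Eq.trans (sdAct_congr ?_ y.2).symm (sdAct_id (n := n.unop) y.1)
    exact lift_cyc (n := n.unop) (m := n.unop) (PeriodicMap.id n.unop.obj) rfl
  map_comp {p m n} g f := by
    refine Pointed.Hom.ext (funext fun y => Subtype.ext ?_)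
    refine Eq.trans (sdAct_congr ?_ y.2).symm
      (sdAct_comp (lift f.unop) (lift g.unop) (lift_deg _) (lift_deg _) y.1).symm
    apply Quotient.exact (s := PeriodicMap.setoid _ _)
    refine Eq.trans ?_ (lift_cls (f.unop ≫ g.unop)).symm
    rw [WideSubcategory.comp_def, ← lift_cls, ← lift_cls]
    rfl

theorem sdFixObj_act (a : ℕ+) (Y : PCyc.{u}) {n m : Cyc} (f : PeriodicMap n.obj m.obj)
    (hf : f.deg = 1) (y : ((sdFixObj a Y).obj (op m)).X) :
    ((sdFixObj a Y).act (f.cyc hf) y).1 = sdAct Y a f hf y.1 :=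
  (sdAct_congr (lift_cyc f hf) y.2).symm

/-- `Y ↦ sd_a(Y)^{C_a}` as a functor: pointed cyclic maps are restricted to fixed points. -/
def sdFix (a : ℕ+) : PCyc.{u} ⥤ PCyc.{u} where
  obj Y := sdFixObj a Y
  map {Y Z} g :=
    { app := fun n =>
        { toFun := fun y => ⟨(g.app (op (sdObj a n.unop))).toFun y.1, fun k => by
            rw [← PCyc.act_nat, y.2 k]⟩
          map_point := Subtype.ext (g.app (op (sdObj a n.unop))).map_point }
      naturality := fun m n f => by
        refine Pointed.Hom.ext (funext fun y => Subtype.ext ?_)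
        exact PCyc.act_nat g _ y.1 }
  map_id Y := rfl
  map_comp g h := rfl

theorem per_sd_one (n : Cyc) : n.obj.per = (sdObj 1 n).obj.per := by
  simp [per_sd]

theorem per_sd_sd {k r b : ℕ+} (h : b = k * r) (n : Cyc) :
    (sdObj r (sdObj k n)).obj.per = (sdObj b n).obj.per := by
  subst h; simp [per_sd]; ring

/-- The identification `sd_1(Y)^{C_1} = Y`. -/
def sdFixOne (Y : PCyc.{u}) : (sdFix 1).obj Y ≅ Y :=
  NatIso.ofComponents
    (fun n =>
      { hom :=
          { toFun := fun y => Y.act (sameHom (per_sd_one n.unop)) y.1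
            map_point := Y.act_point _ }
        inv :=
          { toFun := fun y => ⟨Y.act (sameHom (per_sd_one n.unop).symm) y, fun k => by
              rw [PCyc.act_act]
              congr 1
              refine cyc_eq ⟨-k, fun x => ?_⟩
              change x = x + k * n.unop.obj.per + -k * n.unop.obj.per
              ring⟩
            map_point := Subtype.ext (Y.act_point _) }
        hom_inv_id := Pointed.Hom.ext (funext fun y => Subtype.ext
          ((Y.act_act _ _ _).trans (Y.act_id _ _)))
        inv_hom_id := Pointed.Hom.ext (funext fun y =>
          (Y.act_act _ _ _).trans (Y.act_id _ _)) })
    (fun {m n} f => by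
      refine Pointed.Hom.ext (funext fun y => ?_)
      refine (Y.act_act _ _ _).trans (Eq.trans ?_ (Y.act_act f.unop _ _).symm)
      congr 1
      apply WideSubcategory.hom_ext
      rw [WideSubcategory.comp_def, WideSubcategory.comp_def, ← lift_cls f.unop]
      exact Quotient.sound ⟨0, fun x => by simp [PeriodicMap.comp, PeriodicMap.sd]⟩)

theorem fixMul_hom {Y : PCyc.{u}} {k r b : ℕ+} (h : b = k * r) {n : Cyc}
    (y : (((sdFix k).obj ((sdFix r).obj Y)).obj (op n)).X) :
    IsFix Y b n (Y.act (sameHom (per_sd_sd h n).symm) y.1.1) := by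
  intro j
  have hy : sdAct Y r (n := sdObj k n) (m := sdObj k n) (rot k n.obj j) rfl y.1.1 = y.1.1 :=
    (sdFixObj_act r Y (n := sdObj k n) (m := sdObj k n) (rot k n.obj j) rfl y.1).symm.trans
      (congrArg Subtype.val (y.2 j))
  conv_rhs => rw [← hy]
  unfold sdAct
  rw [PCyc.act_act, PCyc.act_act]
  congr 1

/-- A point fixed by `C_b`, `b = k r`, is fixed by `C_r ⊂ C_b`. -/
theorem fixIncl_fix {Y : PCyc.{u}} {k r b : ℕ+} (h : b = k * r) {n : Cyc}
    (y : (((sdFix b).obj Y).obj (op n)).X) :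
    IsFix Y r (sdObj k n) (Y.act (sameHom (per_sd_sd h n)) y.1) := by
  intro j
  conv_rhs => rw [← y.2 (j * k)]
  rw [PCyc.act_act, PCyc.act_act]
  congr 1
  refine cyc_eq ⟨0, fun x => ?_⟩
  simp [PeriodicMap.comp, rot, per_sd, mul_assoc]

theorem fixMul_inv {Y : PCyc.{u}} {k r b : ℕ+} (h : b = k * r) {n : Cyc}
    (y : (((sdFix b).obj Y).obj (op n)).X) :
    IsFix ((sdFix r).obj Y) k n ⟨Y.act (sameHom (per_sd_sd h n)) y.1, fixIncl_fix h y⟩ := by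
  intro j
  refine Subtype.ext ?_
  refine (sdFixObj_act r Y (n := sdObj k n) (m := sdObj k n) (rot k n.obj j) rfl _).trans ?_
  change sdAct Y r _ _ (Y.act _ y.1) = Y.act _ y.1
  conv_rhs => rw [← y.2 j]
  unfold sdAct
  rw [PCyc.act_act, PCyc.act_act]
  congr 1

/-- The identification `sd_k(sd_r(Y)^{C_r})^{C_k} = sd_b(Y)^{C_b}` for `b = k r`. -/
def sdFixMul (Y : PCyc.{u}) (k r b : ℕ+) (h : b = k * r) :
    (sdFix k).obj ((sdFix r).obj Y) ≅ (sdFix b).obj Y :=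
  NatIso.ofComponents
    (fun n =>
      { hom :=
          { toFun := fun y => ⟨Y.act (sameHom (per_sd_sd h n.unop).symm) y.1.1,
              fixMul_hom h y⟩
            map_point := Subtype.ext (Y.act_point _) }
        inv :=
          { toFun := fun y => ⟨⟨Y.act (sameHom (per_sd_sd h n.unop)) y.1,
              fixIncl_fix h y⟩, fixMul_inv h y⟩
            map_point := Subtype.ext (Subtype.ext (Y.act_point _)) }
        hom_inv_id := Pointed.Hom.ext (funext fun y => Subtype.ext (Subtype.ext
          ((Y.act_act _ _ _).trans (Y.act_id _ _))))
        inv_hom_id := Pointed.Hom.ext (funext fun y => Subtype.ext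
          ((Y.act_act _ _ _).trans (Y.act_id _ _))) })
    (fun {m n} f => by
      refine Pointed.Hom.ext (funext fun y => Subtype.ext ?_)
      refine Eq.trans (congrArg (Y.act _) (sdFixObj_act r Y (n := sdObj k n.unop)
        (m := sdObj k m.unop) ((lift f.unop).sd k) (lift_deg f.unop) y.1)) ?_
      change Y.act _ (sdAct Y r _ _ y.1.1) = Y.act _ (Y.act _ y.1.1)
      unfold sdAct
      rw [PCyc.act_act, PCyc.act_act]
      congr 1
      refine cyc_eq ⟨0, fun x => by simp [PeriodicMap.comp, PeriodicMap.sd]⟩)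

/-! ## Epicyclic spaces -/

/-- An epicyclic space `(Y, φ)`: a pointed cyclic set `Y` with pointed cyclic maps
`φ_q : sd_q(Y)^{C_q} ⟶ Y` such that `φ_1 = Id` and
`φ_k ∘ sd_k(φ_r) = φ_{kr} : sd_k(sd_r(Y)^{C_r})^{C_k} = sd_{kr}(Y)^{C_{kr}} ⟶ Y`. -/
structure EpicyclicSpace : Type (u + 1) where
  Y : PCyc.{u}
  φ : ∀ q : ℕ+, (sdFix q).obj Y ⟶ Y
  φ_one : φ 1 = (sdFixOne Y).hom
  φ_mul : ∀ k r : ℕ+,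
    (sdFix k).map (φ r) ≫ φ k = (sdFixMul Y k r (k * r) rfl).hom ≫ φ (k * r)

/-- A map of the underlying cyclic sets (base points are not required to be preserved). -/
structure CyclicMap (Y Z : PCyc.{u}) : Type u where
  toFun : ∀ n : Cyc, (Y.obj (op n)).X → (Z.obj (op n)).X
  naturality : ∀ {n m : Cyc} (f : n ⟶ m) (y : (Y.obj (op m)).X),
    toFun n (Y.act f y) = Z.act f (toFun m y)

/-- The restriction `sd_a(Y)^{C_a} → sd_a(Z)^{C_a}` of `sd_a(g)`. -/
def CyclicMap.fix {Y Z : PCyc.{u}} (g : CyclicMap Y Z) (a : ℕ+) (n : Cyc)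
    (y : (((sdFix a).obj Y).obj (op n)).X) : (((sdFix a).obj Z).obj (op n)).X :=
  ⟨g.toFun (sdObj a n) y.1, fun k => by rw [← g.naturality, y.2 k]⟩

/-- A morphism of epicyclic spaces with base points forgotten: a map of cyclic sets which commutes
with all the structure maps `φ_q`. -/
structure EpicyclicMap (E E' : EpicyclicSpace.{u}) : Type u extends CyclicMap E.Y E'.Y where
  comm : ∀ (q : ℕ+) (n : Cyc) (y : (((sdFix q).obj E.Y).obj (op n)).X),
    toFun n (((E.φ q).app (op n)).toFun y) =
      ((E'.φ q).app (op n)).toFun (toCyclicMap.fix q n y)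

/-- The map preserves base points. -/
def EpicyclicMap.IsPointed {E E' : EpicyclicSpace.{u}} (g : EpicyclicMap E E') : Prop :=
  ∀ n : Cyc, g.toFun n (E.Y.obj (op n)).point = (E'.Y.obj (op n)).point

/-! ## The category `RF` and the pericyclic category `Π` -/

/-- Objects of `RF`: positive integers. -/
structure RF : Type where
  val : ℕ+

/-- `f_{r,s} : a ⟶ b`, for `a = r b s`. -/
@[ext]
structure RFHom (a b : RF) : Type where
  r : ℕ+
  s : ℕ+
  eq : a.val = r * b.val * s

/-- The category `RF`, with `f_{r,s} ∘ f_{p,q} = f_{rp,sq}`. -/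
instance : Category RF where
  Hom := RFHom
  id a := ⟨1, 1, by simp⟩
  comp f g := ⟨g.r * f.r, g.s * f.s, by rw [f.eq, g.eq]; simp only [mul_assoc, mul_left_comm]⟩
  id_comp f := RFHom.ext (mul_one _) (mul_one _)
  comp_id f := RFHom.ext (one_mul _) (one_mul _)
  assoc f g h := RFHom.ext (mul_assoc _ _ _).symm (mul_assoc _ _ _).symm

/-- `f_{r,s}` as a morphism of `RF`. -/
def RF.f {a b : RF} (r s : ℕ+) (h : a.val = r * b.val * s) : a ⟶ b := RFHom.mk r s h

/-- `Fr(f_{r,s}) = s`. -/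
def Fr {a b : RF} (f : a ⟶ b) : ℕ+ := RFHom.s f

/-- The pairs `(h, f)` of morphisms of `Λ̃ᵒᵖ` and `RF` with `Fr(f) = Mod(h)`. -/
def periProp : MorphismProperty (EpiCatᵒᵖ × RF) := fun _ _ f => Fr f.2 = Mod f.1.unop

instance : periProp.IsMultiplicative where
  id_mem _ := rfl
  comp_mem f g hf hg := by
    change Fr g.2 * Fr f.2 = Mod (g.1.unop ≫ f.1.unop)
    rw [Mod_comp, show Fr f.2 = _ from hf, show Fr g.2 = _ from hg]

/-- The pericyclic category `Π`: the subcategory of `Λ̃ᵒᵖ × RF` with the same objects and whose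
morphisms are the pairs `(h, f)` with `Fr(f) = Mod(h)`. -/
abbrev Peri : Type := WideSubcategory periProp

/-- The object `(n, a)` of `Π`. -/
def Peri.mk (n : Cyc) (a : ℕ+) : Peri := ⟨(op n.obj, ⟨a⟩)⟩

/-- The component `n` of an object `(n, a)`, seen as an object of `Λ`. -/
def Peri.n (X : Peri) : Cyc := ⟨X.obj.1.unop⟩

/-- The component `a` of an object `(n, a)`. -/
def Peri.a (X : Peri) : ℕ+ := X.obj.2.val

/-- The projection `λ : Π ⟶ Λ̃ᵒᵖ`. -/
def periProj : Peri ⥤ EpiCatᵒᵖ :=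
  wideSubcategoryInclusion periProp ⋙ CategoryTheory.Prod.fst EpiCatᵒᵖ RF

/-- `(ℓ, Id_a) : (n, a) ⟶ (m, a)` for `ℓ : n ⟶ m` in `Λᵒᵖ`. -/
def Peri.cyc {n m : Cyc} (l : op n ⟶ op m) (a : ℕ+) : Peri.mk n a ⟶ Peri.mk m a :=
  ⟨(l.unop.hom.op, 𝟙 _), l.unop.property.symm⟩

/-- The morphism `Id_n^u : u (n + 1) - 1 ⟶ n` of `Λ̃` of degree `u`, given by the identity of
`ℤ`. -/
def idPow (n : EpiCat) (u : ℕ+) : n.sd u ⟶ n :=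
  PeriodicMap.cls
    { toFun := fun x => x, deg := u, mono := monotone_id, shift := fun x => by rw [per_sd] }

/-- `χ(n, u, v) = (Id_n^{u,op}, f_{1,u}) : (n, u v) ⟶ (u (n + 1) - 1, v)`. -/
def Peri.chi (n : Cyc) (u v : ℕ+) : Peri.mk n (u * v) ⟶ Peri.mk (sdObj u n) v :=
  ⟨((idPow n.obj u).op, RF.f 1 u (by simp [Peri.mk, mul_comm])), rfl⟩

/-- `(Id_n, f_{q,1}) : (n, q a) ⟶ (n, a)`. -/
def Peri.res (n : Cyc) (q a : ℕ+) : Peri.mk n (q * a) ⟶ Peri.mk n a :=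
  ⟨(𝟙 _, RF.f q 1 (by simp [Peri.mk])), rfl⟩

/-- The set `W` of the morphisms `Id × f_{q,1}` of `Π`. -/
inductive periW : MorphismProperty Peri
  | mk (n : Cyc) (q a : ℕ+) : periW (Peri.res n q a)

/-! ## The functor `β` -/

/-- A functor `C ⥤ Type u` with the prescribed values `F X` on objects. -/
@[ext]
structure FunctorOn {C : Type} [Category.{0} C] (F : C → Type u) : Type u where
  map : ∀ {X Y : C}, (X ⟶ Y) → F X → F Y
  map_id : ∀ (X : C) (x : F X), map (𝟙 X) x = x
  map_comp : ∀ {X Y Z : C} (f : X ⟶ Y) (g : Y ⟶ Z) (x : F X), map (f ≫ g) x = map g (map f x)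

def FunctorOn.toFunctor {C : Type} [Category.{0} C] {F : C → Type u} (β : FunctorOn F) :
    C ⥤ Type u where
  obj := F
  map f := ↾(β.map f)
  map_id X := by ext x; exact β.map_id X x
  map_comp f g := by ext x; exact β.map_comp f g x

/-- The pointed set `sd_a(Y)^{C_a}(n)` attached to the object `(n, a)` of `Π`. -/
def EpicyclicSpace.val (E : EpicyclicSpace.{u}) (X : Peri) : Pointed.{u} :=
  ((sdFix X.a).obj E.Y).obj (op X.n)

/-- The inclusion `sd_{uv}(Y)^{C_{uv}}(n) ⊂ sd_v(Y)^{C_v}(u (n + 1) - 1)` of subsets of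
`Y(u v (n + 1) - 1)`. -/
def fixIncl (Y : PCyc.{u}) (n : Cyc) (b c : ℕ+)
    (y : (((sdFix (b * c)).obj Y).obj (op n)).X) :
    (((sdFix c).obj Y).obj (op (sdObj b n))).X :=
  ⟨Y.act (sameHom (per_sd_sd rfl n)) y.1, fixIncl_fix rfl y⟩

/-- The structure map
`φ_q : sd_{qa}(Y)^{C_{qa}} = sd_a(sd_q(Y)^{C_q})^{C_a} ⟶ sd_a(Y)^{C_a}` induced by `φ_q`. -/
def EpicyclicSpace.phi (E : EpicyclicSpace.{u}) (q a : ℕ+) :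
    (sdFix (q * a)).obj E.Y ⟶ (sdFix a).obj E.Y :=
  (sdFixMul E.Y a q (q * a) (mul_comm q a)).inv ≫ (sdFix a).map (E.φ q)

/-- The equalities which define `β` on the generators of `Π`. -/
structure IsBeta (E : EpicyclicSpace.{u}) (β : FunctorOn fun X : Peri => (E.val X).X) : Prop where
  cyc : ∀ {n m : Cyc} (l : op n ⟶ op m) (a : ℕ+),
    β.map (Peri.cyc l a) = (((sdFix a).obj E.Y).map l).toFun
  chi : ∀ (n : Cyc) (u v : ℕ+), β.map (Peri.chi n u v) = fixIncl E.Y n u v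
  res : ∀ (n : Cyc) (q a : ℕ+), β.map (Peri.res n q a) = ((E.phi q a).app (op n)).toFun

/-- The maps `sd_a(Y)^{C_a}(n) → sd_a(Y')^{C_a}(n)` induced by a map of epicyclic spaces. -/
def EpicyclicMap.onVal {E E' : EpicyclicSpace.{u}} (g : EpicyclicMap E E') (X : Peri) :
    (E.val X).X → (E'.val X).X :=
  g.toCyclicMap.fix X.a X.n

end

end Pericyclic

open Pericyclic

namespace Pericyclic

noncomputable section

/-! ## Morphisms of the pericyclic category -/

/-! A map `g : m → n` of degree `s` is the same map of ℤ as a degree-one map into `s(n+1)-1`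
followed by `Id_n^s`. Hence every morphism `(h, f_{r,s})` of `Π` is a morphism `f_{r,1}`, then a
`χ`, then a morphism of `Λᵒᵖ` (`Peri.hom_induction`). Uniqueness of `β`, preservation of base points
and naturality of the maps induced by `g : Y → Y'` are then checked on these three kinds of
generators.

For existence, `β(h, f_{r,s})` is defined at once as `φ_r` followed by pullback along `h`, seen as a
degree-one map between subdivisions (`betaMk`). Representatives of `h` differ by translations, which
act trivially on fixed points (`fixPull_congr`). Functoriality combines the composition law of the
`φ_q` (`phiMap_phiMap`), that of pullbacks (`fixPull_comp`) and an exchange law, which is naturality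
of `φ_q` (`phiMap_fixPull`).

For faithfulness, `Y = sd_1(Y)^{C_1}`, so the components at `(n, 1)` of a natural transformation
give a map `Y → Y'`. Naturality along the inclusion `(n, a) → (a(n+1)-1, 1)` shows that this map
determines every other component (`natTransFun_fix`), and naturality along `(n, q) → (n, 1)` gives
compatibility with `φ_q`.

For the last part, `λ` sends each `f_{q,1}` to an identity, and each `h` of `Λ̃` lifts to `(n, Mod
h) → (m, 1)`. A functor inverting the `f_{q,1}` therefore sends `h` to a map `F(n, 1) → F(m, 1)`
through a fraction; `map_resIso` gives both its functoriality and the comparison with `F`. -/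

/-- The morphism `(h, f_{r,s}) : (n, a) ⟶ (m, b)` of `Π`. -/
def Peri.homMk {n m : Cyc} {a b : ℕ+} (h : m.obj ⟶ n.obj) (r s : ℕ+) (hs : Mod h = s)
    (e : a = r * b * s) : Peri.mk n a ⟶ Peri.mk m b :=
  ⟨(h.op, RF.f r s e), hs.symm⟩

/-- The component in `Λ̃` of a morphism of `Π`. -/
def Peri.epi {X X' : Peri} (f : X ⟶ X') : X'.n.obj ⟶ X.n.obj := f.hom.1.unop

/-- The index `r` of the component `f_{r,s}` of a morphism of `Π`. -/
def Peri.r {X X' : Peri} (f : X ⟶ X') : ℕ+ := RFHom.r f.hom.2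

/-- The index `s` of the component `f_{r,s}` of a morphism of `Π`. -/
def Peri.s {X X' : Peri} (f : X ⟶ X') : ℕ+ := RFHom.s f.hom.2

theorem Peri.a_eq {X X' : Peri} (f : X ⟶ X') : X.a = Peri.r f * X'.a * Peri.s f :=
  RFHom.eq f.hom.2

theorem Peri.Mod_epi {X X' : Peri} (f : X ⟶ X') : Mod (Peri.epi f) = Peri.s f :=
  f.property.symm

theorem Peri.exists_homMk {n m : Cyc} {a b : ℕ+} (f : Peri.mk n a ⟶ Peri.mk m b) :
    ∃ (h : m.obj ⟶ n.obj) (r s : ℕ+) (hs : Mod h = s) (e : a = r * b * s),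
      f = Peri.homMk h r s hs e :=
  ⟨Peri.epi f, Peri.r f, Peri.s f, Peri.Mod_epi f, Peri.a_eq f, rfl⟩

/-- The index `s` is forced by `Fr = Mod`, so only `h` and `r` need comparing. -/
theorem Peri.hom_ext {X X' : Peri} {f g : X ⟶ X'} (h : Peri.epi f = Peri.epi g)
    (hr : Peri.r f = Peri.r g) : f = g := by
  have hs : Peri.s f = Peri.s g := by rw [← Peri.Mod_epi, ← Peri.Mod_epi, h]
  exact WideSubcategory.hom_ext _ (Prod.ext (congrArg Quiver.Hom.op h) (RFHom.ext hr hs))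

/-- A periodic map of degree `u` into `n` as a map of degree one into `u (n + 1) - 1`. -/
def PeriodicMap.toSd {n m : EpiCat} (f : PeriodicMap m n) (u : ℕ+) (hu : f.deg = u) :
    PeriodicMap m (n.sd u) where
  toFun := f.toFun
  deg := 1
  mono := f.mono
  shift x := by rw [f.shift, hu, per_sd]; simp

/-- The morphisms of `Π` are generated by those used to define `β`. -/
theorem Peri.hom_induction (P : MorphismProperty Peri) [P.IsStableUnderComposition]
    (cyc : ∀ {n m : Cyc} (l : op n ⟶ op m) (a : ℕ+), P (Peri.cyc l a))
    (chi : ∀ (n : Cyc) (u v : ℕ+), P (Peri.chi n u v))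
    (res : ∀ (n : Cyc) (q a : ℕ+), P (Peri.res n q a)) {X X' : Peri} (f : X ⟶ X') : P f := by
  have key : ∀ (n m : Cyc) (a b : ℕ+) (f : Peri.mk n a ⟶ Peri.mk m b), P f := by
    intro n m a b f
    obtain ⟨h, r, s, hs, e, rfl⟩ := Peri.exists_homMk f
    obtain ⟨g, rfl⟩ := Quotient.exists_rep h
    have e' : a = r * (s * b) := by rw [e, mul_assoc, mul_comm b]
    subst e'
    have hg : g.deg = s := hs
    -- The degree `s` is carried by `χ`, which leaves `g` with degree one into the `s`-fold
    -- subdivision.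
    have hf : Peri.homMk (n := n) (m := m) (Quotient.mk _ g) r s hs e =
        Peri.res n r (s * b) ≫ Peri.chi n s b ≫
          Peri.cyc (n := sdObj s n) (m := m)
            (PeriodicMap.cyc (n := m) (m := sdObj s n) (g.toSd s hg) rfl).op b := by
      have hr : r = 1 * 1 * r := by simp
      refine Peri.hom_ext (Quotient.sound ⟨0, fun x => ?_⟩) hr
      simp [PeriodicMap.comp, PeriodicMap.toSd, PeriodicMap.id]
    rw [hf]
    exact P.comp_mem _ _ (res _ _ _) (P.comp_mem _ _ (chi _ _ _) (cyc _ _))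
  exact key X.n X'.n X.a X'.a f

/-! ## The action on fixed points of a periodic map of arbitrary degree -/

/-- Composite actions agree as soon as the underlying maps of ℤ do, whatever the intermediate
objects. This absorbs the identifications `sameHom` between objects of equal period. -/
theorem PCyc.act_cyc_eq (Y : PCyc.{u}) {n m m' p : Cyc} {f : PeriodicMap n.obj m.obj}
    {g : PeriodicMap m.obj p.obj} {f' : PeriodicMap n.obj m'.obj} {g' : PeriodicMap m'.obj p.obj}
    {hf : f.deg = 1} {hg : g.deg = 1} {hf' : f'.deg = 1} {hg' : g'.deg = 1}
    (h : ∀ x, g.toFun (f.toFun x) = g'.toFun (f'.toFun x)) (y : (Y.obj (op p)).X) :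
    Y.act (f.cyc hf) (Y.act (g.cyc hg) y) = Y.act (f'.cyc hf') (Y.act (g'.cyc hg') y) := by
  rw [PCyc.act_act, PCyc.act_act]
  congr 1
  refine cyc_eq (f := f.comp g) (g := f'.comp g') (hf := by simp [PeriodicMap.comp, hf, hg])
    (hg := by simp [PeriodicMap.comp, hf', hg']) ⟨0, fun x => ?_⟩
  simp [PeriodicMap.comp, h]

theorem PCyc.act_cyc_cyc (Y : PCyc.{u}) {n m p : Cyc} {f : PeriodicMap n.obj m.obj}
    {g : PeriodicMap m.obj p.obj} {k : PeriodicMap n.obj p.obj} {hf : f.deg = 1}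
    {hg : g.deg = 1} {hk : k.deg = 1} (h : ∀ x, g.toFun (f.toFun x) = k.toFun x)
    (y : (Y.obj (op p)).X) : Y.act (f.cyc hf) (Y.act (g.cyc hg) y) = Y.act (k.cyc hk) y := by
  rw [PCyc.act_act]
  congr 1
  refine cyc_eq (f := f.comp g) (hf := by simp [PeriodicMap.comp, hf, hg]) ⟨0, fun x => ?_⟩
  simp [PeriodicMap.comp, h]

/-- A periodic map `m → n` of degree `d` as a map of degree one between the `b`-fold
subdivision of `m` and the `b d`-fold subdivision of `n`. -/
def PeriodicMap.sdDeg {n m : EpiCat} (f : PeriodicMap m n) (b c : ℕ+) (h : c = b * f.deg) :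
    PeriodicMap (m.sd b) (n.sd c) where
  toFun := f.toFun
  deg := 1
  mono := f.mono
  shift x := by rw [per_sd, per_sd, f.shift_mul, h]; push_cast; ring

/-- The map `sd_c(Y)^{C_c}(n) → sd_b(Y)^{C_b}(m)` induced by a periodic map `m → n` of degree
`d`, for `c = b d`. -/
def fixPull (Y : PCyc.{u}) {n m : Cyc} (f : PeriodicMap m.obj n.obj) (b c : ℕ+)
    (h : c = b * f.deg) (y : (((sdFix c).obj Y).obj (op n)).X) :
    (((sdFix b).obj Y).obj (op m)).X :=
  ⟨Y.act (PeriodicMap.cyc (n := sdObj b m) (m := sdObj c n) (f.sdDeg b c h) rfl) y.1, fun k => by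
    -- Translation by `k` periods in the source becomes translation by `k * f.deg` periods in the
    -- target, an element of `C_c`, which fixes `y`.
    conv_rhs => rw [← y.2 (k * f.deg)]
    exact PCyc.act_cyc_eq Y (fun x => f.shift_mul x k) y.1⟩

/-- Two representatives differ by a translation by a multiple of the period of `n`, and this lies in
`C_c`, which fixes `y`. -/
theorem fixPull_congr {Y : PCyc.{u}} {n m : Cyc} {f g : PeriodicMap m.obj n.obj} {b c : ℕ+}
    {h : c = b * f.deg} {h' : c = b * g.deg} (e : f.cls = g.cls)
    (y : (((sdFix c).obj Y).obj (op n)).X) : fixPull Y f b c h y = fixPull Y g b c h' y := by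
  obtain ⟨k, e⟩ : f ≈ g := Quotient.exact e
  refine Subtype.ext ?_
  dsimp only [fixPull]
  conv_lhs => rw [← y.2 k]
  exact PCyc.act_cyc_cyc Y (fun x => (e x).symm) y.1

theorem fixPull_id {Y : PCyc.{u}} {n : Cyc} {b : ℕ+} {h : b = b * 1}
    (y : (((sdFix b).obj Y).obj (op n)).X) :
    fixPull Y (m := n) (PeriodicMap.id n.obj) b b h y = y :=
  Subtype.ext (Y.act_id (sdObj b n) y.1)

theorem fixPull_comp {Y : PCyc.{u}} {n m p : Cyc} (f : PeriodicMap m.obj n.obj)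
    (g : PeriodicMap p.obj m.obj) (b c d : ℕ+) (h : c = b * g.deg) (h' : d = c * f.deg)
    (y : (((sdFix d).obj Y).obj (op n)).X) :
    fixPull Y g b c h (fixPull Y f c d h' y) =
      fixPull Y (g.comp f) b d (by rw [h', h, mul_assoc]; rfl) y :=
  Subtype.ext (PCyc.act_cyc_cyc Y (fun _ => rfl) y.1)

/-- A representative of a morphism of `Λ̃`. -/
def rep {n m : EpiCat} (h : m ⟶ n) : PeriodicMap m n :=
  Quotient.out (s := PeriodicMap.setoid m n) h

theorem rep_cls {n m : EpiCat} (h : m ⟶ n) : (rep h).cls = h :=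
  Quotient.out_eq (s := PeriodicMap.setoid m n) h

theorem rep_deg {X X' : Peri} (f : X ⟶ X') :
    (rep (Peri.epi f)).deg = Peri.s f :=
  (congrArg Mod (rep_cls (Peri.epi f))).trans (Peri.Mod_epi f)

/-! ## The structure maps of an epicyclic space -/

theorem IsFix.act_sameHom {Y : PCyc.{u}} {k r b : ℕ+} (h : b = k * r) {n : Cyc}
    {y : (Y.obj (op (sdObj b n))).X} (hy : IsFix Y b n y) :
    IsFix Y r (sdObj k n) (Y.act (sameHom (per_sd_sd h n)) y) :=
  fixIncl_fix h ⟨y, hy⟩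

namespace EpicyclicSpace

variable (E : EpicyclicSpace.{u})

/-- The map `φ_q` on fixed points. -/
def phiFix (q : ℕ+) (n : Cyc) (y : (E.Y.obj (op (sdObj q n))).X) (hy : IsFix E.Y q n y) :
    (E.Y.obj (op n)).X :=
  ((E.φ q).app (op n)).toFun ⟨y, hy⟩

/-- Allows the point to be rewritten although the proof of its fixedness depends on it. -/
theorem phiFix_congr {q q' : ℕ+} {n : Cyc} {y : (E.Y.obj (op (sdObj q n))).X}
    {y' : (E.Y.obj (op (sdObj q' n))).X} (hq : q' = q)
    (e : y = E.Y.act (sameHom (by rw [hq])) y') (hy : IsFix E.Y q n y)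
    (hy' : IsFix E.Y q' n y') : E.phiFix q n y hy = E.phiFix q' n y' hy' := by
  subst hq
  have e' : y = y' := e.trans (E.Y.act_id _ y')
  subst e'
  rfl

/-- Naturality of `φ_q` over `Λ`, written on points of `Y` instead of the subtype of fixed points.
-/
theorem phiFix_sdAct (q : ℕ+) {n m : Cyc} (f : PeriodicMap n.obj m.obj) (hf : f.deg = 1)
    (y : (E.Y.obj (op (sdObj q m))).X) (hy : IsFix E.Y q m y) :
    E.phiFix q n (sdAct E.Y q f hf y) (hy.sdAct f hf) =
      E.Y.act (f.cyc hf) (E.phiFix q m y hy) := by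
  refine Eq.trans ?_ (PCyc.act_nat (E.φ q) (f.cyc hf) ⟨y, hy⟩)
  exact congrArg _ (Subtype.ext (sdFixObj_act q E.Y f hf ⟨y, hy⟩).symm)

theorem phiFix_one (n : Cyc) (y : (E.Y.obj (op (sdObj 1 n))).X) (hy : IsFix E.Y 1 n y) :
    E.phiFix 1 n y hy = E.Y.act (sameHom (per_sd_one n)) y := by
  unfold phiFix
  rw [E.φ_one]
  rfl

/-- The value is a point of the image of `sd_a(φ_q)`, which lands in the `C_a`-fixed points. -/
theorem phiFix_fixed (q c a : ℕ+) (h : c = a * q) {n : Cyc} {y : (E.Y.obj (op (sdObj c n))).X}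
    (hy : IsFix E.Y c n y) :
    IsFix E.Y a n (E.phiFix q (sdObj a n) (E.Y.act (sameHom (per_sd_sd h n)) y)
      (hy.act_sameHom h)) :=
  (((sdFixMul E.Y a q c h).inv ≫ (sdFix a).map (E.φ q)).app (op n)).toFun ⟨y, hy⟩ |>.2

/-- `φ_k ∘ sd_k(φ_r) = φ_{kr}`. -/
theorem phiFix_phiFix (k r : ℕ+) (n : Cyc) (y : (E.Y.obj (op (sdObj (k * r) n))).X)
    (hy : IsFix E.Y (k * r) n y) :
    E.phiFix k n (E.phiFix r (sdObj k n) (E.Y.act (sameHom (per_sd_sd rfl n)) y)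
      (hy.act_sameHom rfl)) (E.phiFix_fixed r (k * r) k rfl hy) = E.phiFix (k * r) n y hy := by
  -- The axiom is evaluated at the point of the iterated fixed points that corresponds to `y`.
  have h := congrArg (fun t => (t.app (op n)).toFun
    (((sdFixMul E.Y k r (k * r) rfl).inv.app (op n)).toFun ⟨y, hy⟩)) (E.φ_mul k r)
  refine Eq.trans (Eq.trans ?_ h) ?_
  · rfl
  · refine congrArg ((E.φ (k * r)).app (op n)).toFun (Subtype.ext ?_)
    exact (E.Y.act_act _ _ _).trans (E.Y.act_id _ _)

/-- The map `sd_c(Y)^{C_c} → sd_a(Y)^{C_a}` induced by `φ_q`, for `c = a q`. -/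
def phiMap (q c a : ℕ+) (h : c = a * q) (n : Cyc) (y : (((sdFix c).obj E.Y).obj (op n)).X) :
    (((sdFix a).obj E.Y).obj (op n)).X :=
  ⟨E.phiFix q (sdObj a n) (E.Y.act (sameHom (per_sd_sd h n)) y.1) (y.2.act_sameHom h),
    E.phiFix_fixed q c a h y.2⟩

theorem phiMap_one {a : ℕ+} {h : a = a * 1} {n : Cyc} (y : (((sdFix a).obj E.Y).obj (op n)).X) :
    E.phiMap 1 a a h n y = y := by
  refine Subtype.ext ?_
  dsimp only [phiMap]
  rw [phiFix_one]
  exact (E.Y.act_act _ _ _).trans (E.Y.act_id _ _)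

/-- The axiom `φ_k ∘ sd_k(φ_r) = φ_{kr}` applied at the subdivided object `sdObj a n`. -/
theorem phiMap_phiMap (q q' d c a : ℕ+) (h : c = a * q) (h' : d = c * q') (n : Cyc)
    (y : (((sdFix d).obj E.Y).obj (op n)).X) :
    E.phiMap q c a h n (E.phiMap q' d c h' n y) =
      E.phiMap (q * q') d a (by rw [h', h, mul_assoc]) n y := by
  have hd : d = a * (q * q') := by rw [h', h, mul_assoc]
  refine Subtype.ext ?_
  refine Eq.trans ?_ (E.phiFix_phiFix q q' (sdObj a n) _ (y.2.act_sameHom hd))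
  refine E.phiFix_congr rfl (Eq.trans ?_ (E.Y.act_id _ _).symm) _ _
  -- Naturality of `φ_{q'}` moves the identification of `sdObj q (sdObj a n)` with `sdObj c n`
  -- inside its argument.
  refine (E.phiFix_sdAct q' (n := sdObj q (sdObj a n)) (m := sdObj c n) _ rfl _ _).symm.trans ?_
  refine E.phiFix_congr rfl (Eq.trans ?_ (E.Y.act_id _ _).symm) _ _
  exact PCyc.act_cyc_eq E.Y (fun _ => by rfl) _

/-- Exchange law: `f` is a degree-one map from the `a`-fold subdivision of `m` to the `b`-fold one
of `n`, and `φ_q` is natural for it. -/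
theorem phiMap_fixPull (q : ℕ+) {n m : Cyc} (f : PeriodicMap m.obj n.obj) (a b c d : ℕ+)
    (h : c = a * q) (h' : d = c * f.deg) (k : b = a * f.deg) (k' : d = b * q)
    (y : (((sdFix d).obj E.Y).obj (op n)).X) :
    E.phiMap q c a h m (fixPull E.Y f c d h' y) =
      fixPull E.Y f a b k (E.phiMap q d b k' n y) := by
  refine Subtype.ext ?_
  refine Eq.trans ?_ (E.phiFix_sdAct q (n := sdObj a m) (m := sdObj b n) (f.sdDeg a b k) rfl _ _)
  refine E.phiFix_congr rfl (Eq.trans ?_ (E.Y.act_id _ _).symm) _ _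
  exact PCyc.act_cyc_eq E.Y (fun _ => by rfl) _

/-! ## The functor `β` -/

/-- The map `β(h, f_{r,s})`, where `g` represents `h`, as the composite
`sd_a(Y)^{C_a}(n) → sd_c(Y)^{C_c}(n) → sd_b(Y)^{C_b}(m)` for `c = b s`. -/
def betaMk {n m : Cyc} {a b : ℕ+} (g : PeriodicMap m.obj n.obj) (r c : ℕ+)
    (hc : c = b * g.deg) (ha : a = c * r) (y : (((sdFix a).obj E.Y).obj (op n)).X) :
    (((sdFix b).obj E.Y).obj (op m)).X :=
  fixPull E.Y g b c hc (E.phiMap r a c ha n y)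

theorem betaMk_congr {n m : Cyc} {a b : ℕ+} {g g' : PeriodicMap m.obj n.obj} {r r' c c' : ℕ+}
    {hc : c = b * g.deg} {ha : a = c * r} {hc' : c' = b * g'.deg} {ha' : a = c' * r'}
    (hg : g.cls = g'.cls) (hr : r = r') (y : (((sdFix a).obj E.Y).obj (op n)).X) :
    E.betaMk g r c hc ha y = E.betaMk g' r' c' hc' ha' y := by
  subst hr
  have hd : g.deg = g'.deg := congrArg Mod hg
  obtain rfl : c = c' := by rw [hc, hc', hd]
  exact fixPull_congr hg _

/-- The exchange law moves `φ_{r'}` past the pullback along `g`; the two structure maps and the two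
pullbacks then compose separately. -/
theorem betaMk_comp {n m p : Cyc} {a b c d e t : ℕ+} (g : PeriodicMap m.obj n.obj) (r : ℕ+)
    (hd : d = b * g.deg) (ha : a = d * r) (g' : PeriodicMap p.obj m.obj) (r' : ℕ+)
    (he : e = c * g'.deg) (hb : b = e * r') (ht : t = c * (g'.comp g).deg)
    (ha' : a = t * (r' * r)) (y : (((sdFix a).obj E.Y).obj (op n)).X) :
    E.betaMk g' r' e he hb (E.betaMk g r d hd ha y) =
      E.betaMk (g'.comp g) (r' * r) t ht ha' y := by
  have h1 : t = e * g.deg := by rw [ht, he, mul_assoc]; rfl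
  unfold betaMk
  rw [E.phiMap_fixPull r' g e t b d hb hd h1 (by rw [hd, hb, h1, mul_right_comm]),
    phiMap_phiMap, fixPull_comp]

/-- The functor `β` attached to an epicyclic space. -/
def beta : FunctorOn fun X : Peri => (E.val X).X where
  map {X X'} f y := E.betaMk (n := X.n) (m := X'.n) (b := X'.a) (rep (Peri.epi f))
    (Peri.r f) (X'.a * Peri.s f) (by rw [rep_deg])
    ((Peri.a_eq f).trans (by rw [mul_comm _ (Peri.r _), ← mul_assoc])) y
  map_id X y := by
    refine (E.betaMk_congr (g' := PeriodicMap.id X.n.obj) (r' := 1) (c' := X.a)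
      (hc' := (mul_one _).symm) (ha' := (mul_one _).symm) (rep_cls _) rfl y).trans ?_
    exact (fixPull_id (h := (mul_one _).symm) _).trans (E.phiMap_one y)
  map_comp {X X' X''} f f' y := by
    have h : ((rep (Peri.epi f')).comp (rep (Peri.epi f))).cls =
        (Peri.epi f') ≫ (Peri.epi f) := by
      conv_rhs => rw [← rep_cls (Peri.epi f'), ← rep_cls (Peri.epi f)]
      rfl
    have hd : ((rep (Peri.epi f')).comp (rep (Peri.epi f))).deg =
        Peri.s f' * Peri.s f := by
      rw [← rep_deg f, ← rep_deg f']
      rfl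
    have e : X.a = Peri.r f * X'.a * Peri.s f := Peri.a_eq f
    have e' : X'.a = Peri.r f' * X''.a * Peri.s f' := Peri.a_eq f'
    refine (E.betaMk_congr ((rep_cls _).trans h.symm) rfl y).trans
      (E.betaMk_comp (n := X.n) (m := X'.n) (p := X''.n) _ _ _ _ _ _ _ _
        (t := X''.a * (Peri.s f' * Peri.s f)) ?_ ?_ y).symm
    · rw [hd]
    · change X.a = _ * (Peri.r f' * Peri.r f)
      rw [e, e']
      simp only [mul_assoc, mul_comm, mul_left_comm]

theorem beta_homMk {n m : Cyc} {a b : ℕ+} (g : PeriodicMap m.obj n.obj) (r s c : ℕ+)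
    (hs : Mod g.cls = s) (e : a = r * b * s) (hc : c = b * g.deg) (ha : a = c * r)
    (y : (((sdFix a).obj E.Y).obj (op n)).X) :
    E.beta.map (Peri.homMk g.cls r s hs e) y = E.betaMk g r c hc ha y :=
  E.betaMk_congr (rep_cls _) rfl y

theorem isBeta_beta : IsBeta E E.beta where
  cyc {n m} l a := by
    funext y
    refine (E.betaMk_congr (n := n) (m := m) (g' := lift l.unop) (r' := 1) (c' := a)
      (hc' := by rw [lift_deg, mul_one]; rfl) (ha' := (mul_one _).symm)
      ((rep_cls _).trans (lift_cls _).symm) rfl y).trans ?_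
    refine (congrArg (fixPull E.Y (n := n) (m := m) (lift l.unop) a a
      (by rw [lift_deg, mul_one])) (E.phiMap_one (h := (mul_one a).symm) y)).trans
      (Subtype.ext ?_)
    refine congrArg (fun t => E.Y.act t y.1) (cyc_eq (n := sdObj a m) (m := sdObj a n) ⟨0, ?_⟩)
    intro x
    simp [PeriodicMap.sd, PeriodicMap.sdDeg]
  chi n u v := by
    funext y
    refine (E.beta_homMk (n := n) (m := sdObj u n) _ 1 u (u * v) rfl _ (mul_comm _ _)
      (mul_one _).symm y).trans ?_
    exact congrArg (fixPull E.Y (n := n) (m := sdObj u n) _ _ _ _) (E.phiMap_one y)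
  res n q a := by
    funext y
    refine (E.beta_homMk (n := n) (m := n) (PeriodicMap.id n.obj) q 1 a rfl _ (mul_one _).symm
      (mul_comm _ _) y).trans ?_
    exact fixPull_id (h := (mul_one _).symm) _

end EpicyclicSpace

/-- The functor `β` is determined by its values on the generators of `Π`. -/
theorem IsBeta.eq {E : EpicyclicSpace.{u}}
    {β β' : FunctorOn fun X : Peri => (E.val X).X} (h : IsBeta E β) (h' : IsBeta E β') :
    β = β' := by
  let P : MorphismProperty Peri := fun _ _ f => β.map f = β'.map f
  have : P.IsStableUnderComposition := ⟨fun f g hf hg => by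
    have hf : β.map f = β'.map f := hf
    have hg : β.map g = β'.map g := hg
    funext x
    rw [β.map_comp, β'.map_comp, hf, hg]⟩
  have key : ∀ {X X' : Peri} (f : X ⟶ X'), β.map f = β'.map f := fun f =>
    Peri.hom_induction P (fun l a => (h.cyc l a).trans (h'.cyc l a).symm)
      (fun n u v => (h.chi n u v).trans (h'.chi n u v).symm)
      (fun n q a => (h.res n q a).trans (h'.res n q a).symm) f
  ext X X' f x
  rw [key f]

theorem IsBeta.map_point {E : EpicyclicSpace.{u}}
    {β : FunctorOn fun X : Peri => (E.val X).X} (h : IsBeta E β) {X X' : Peri} (f : X ⟶ X') :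
    β.map f (E.val X).point = (E.val X').point := by
  let P : MorphismProperty Peri := fun X X' f => β.map f (E.val X).point = (E.val X').point
  have : P.IsStableUnderComposition := ⟨fun f g hf hg => by
    change β.map _ _ = _
    rw [β.map_comp]
    exact (congrArg (β.map g) hf).trans hg⟩
  refine Peri.hom_induction P (fun {n m} l a => ?_) (fun n u v => ?_) (fun n q a => ?_) f
  · change β.map _ _ = _
    rw [h.cyc]
    exact (((sdFix a).obj E.Y).map l).map_point
  · change β.map _ _ = _
    rw [h.chi]
    exact Subtype.ext (E.Y.act_point _)
  · change β.map _ _ = _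
    rw [h.res]
    exact ((E.phi q a).app (op n)).map_point

/-! ## Maps of epicyclic spaces and natural transformations -/

section

variable {E E' : EpicyclicSpace.{u}} {β : FunctorOn fun X : Peri => (E.val X).X}
  {β' : FunctorOn fun X : Peri => (E'.val X).X}

theorem EpicyclicMap.fix_phiMap (g : EpicyclicMap E E') (q c a : ℕ+) (h : c = a * q) (n : Cyc)
    (y : (((sdFix c).obj E.Y).obj (op n)).X) :
    g.fix a n (E.phiMap q c a h n y) = E'.phiMap q c a h n (g.fix c n y) := by
  refine Subtype.ext ((g.comm q (sdObj a n) _).trans ?_)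
  exact E'.phiFix_congr rfl ((g.naturality _ _).trans (E'.Y.act_id _ _).symm) _ _

/-- On the first two kinds of generators this is cyclic naturality of `g`; on `f_{q,1}` it is
compatibility with `φ_q`. -/
theorem EpicyclicMap.onVal_map (g : EpicyclicMap E E') (h : IsBeta E β) (h' : IsBeta E' β')
    {X X' : Peri} (f : X ⟶ X') (y : (E.val X).X) :
    g.onVal X' (β.map f y) = β'.map f (g.onVal X y) := by
  let P : MorphismProperty Peri := fun X X' f =>
    ∀ y : (E.val X).X, g.onVal X' (β.map f y) = β'.map f (g.onVal X y)
  have : P.IsStableUnderComposition := ⟨fun f f' hf hf' y => by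
    rw [β.map_comp, β'.map_comp, hf', hf]⟩
  refine Peri.hom_induction P (fun l a y => ?_) (fun n u v y => ?_) (fun n q a y => ?_) f y
  · rw [h.cyc, h'.cyc]
    exact Subtype.ext (g.naturality _ _)
  · rw [h.chi, h'.chi]
    exact Subtype.ext (g.naturality _ _)
  · rw [h.res, h'.res]
    exact g.fix_phiMap q (q * a) a (mul_comm q a) n y

/-! ### Recovering a cyclic map from the components at `(n, 1)` -/

/-- A point of `Y(n)` as a point of `sd_1(Y)^{C_1}(n)`. -/
def toFixOne (Y : PCyc.{u}) (n : Cyc) (y : (Y.obj (op n)).X) :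
    (((sdFix 1).obj Y).obj (op n)).X :=
  ((sdFixOne Y).inv.app (op n)).toFun y

theorem act_toFixOne (Y : PCyc.{u}) (n : Cyc) (y : (Y.obj (op n)).X) :
    Y.act (sameHom (per_sd_one n)) (toFixOne Y n y).1 = y :=
  (Y.act_act _ _ _).trans (Y.act_id _ _)

theorem CyclicMap.toFun_eq_fix_one {Y Z : PCyc.{u}} (g : CyclicMap Y Z) (n : Cyc)
    (y : (Y.obj (op n)).X) :
    g.toFun n y = Z.act (sameHom (per_sd_one n)) (g.fix 1 n (toFixOne Y n y)).1 := by
  conv_lhs => rw [← act_toFixOne Y n y, g.naturality]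
  rfl

theorem EpicyclicMap.ext_onVal {g g' : EpicyclicMap E E'}
    (h : ∀ X (y : (E.val X).X), g.onVal X y = g'.onVal X y) : g = g' := by
  obtain ⟨⟨g, hg⟩, hg'⟩ := g
  obtain ⟨⟨k, hk⟩, hk'⟩ := g'
  have : g = k := by
    funext n y
    refine (CyclicMap.toFun_eq_fix_one ⟨g, hg⟩ n y).trans
      (Eq.trans ?_ (CyclicMap.toFun_eq_fix_one ⟨k, hk⟩ n y).symm)
    exact congrArg (fun t => E'.Y.act (sameHom (per_sd_one n)) t.1)
      (h (Peri.mk n 1) (toFixOne E.Y n y))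
  subst this
  rfl

/-- The base point of `sd_a(Y)^{C_a}(n)` is that of `Y(a(n+1)-1)`; conversely the objects `(n, 1)`
suffice. -/
theorem EpicyclicMap.isPointed_iff (g : EpicyclicMap E E') :
    g.IsPointed ↔ ∀ X : Peri, g.onVal X (E.val X).point = (E'.val X).point := by
  refine ⟨fun h X => Subtype.ext (h (sdObj X.a X.n)), fun h n => ?_⟩
  refine (g.toFun_eq_fix_one n _).trans ?_
  have e : toFixOne E.Y n (E.Y.obj (op n)).point = (E.val (Peri.mk n 1)).point :=
    Subtype.ext (E.Y.act_point _)
  rw [e]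
  refine (congrArg (fun t => E'.Y.act (sameHom (per_sd_one n)) t.1) (h (Peri.mk n 1))).trans ?_
  exact E'.Y.act_point _

theorem IsBeta.map_homMk (h : IsBeta E β) {n m : Cyc} {a b : ℕ+}
    (g : PeriodicMap m.obj n.obj) (r s c : ℕ+) (hs : Mod g.cls = s) (e : a = r * b * s)
    (hc : c = b * g.deg) (ha : a = c * r) (y : (((sdFix a).obj E.Y).obj (op n)).X) :
    β.map (Peri.homMk g.cls r s hs e) y = E.betaMk g r c hc ha y := by
  rw [h.eq E.isBeta_beta]
  exact E.beta_homMk g r s c hs e hc ha y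

theorem natTrans_map (η : β.toFunctor ⟶ β'.toFunctor) {X X' : Peri} (f : X ⟶ X')
    (y : (E.val X).X) :
    η.app X' (β.map f y) = β'.map f (show (E'.val X).X from η.app X y) :=
  ConcreteCategory.congr_hom (η.naturality f) y

/-- A natural transformation commutes with the maps induced by periodic maps. -/
theorem natTrans_fixPull (h : IsBeta E β) (h' : IsBeta E' β')
    (η : β.toFunctor ⟶ β'.toFunctor) {n m : Cyc} (g : PeriodicMap m.obj n.obj) (b c : ℕ+)
    (hc : c = b * g.deg) (y : (((sdFix c).obj E.Y).obj (op n)).X) :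
    η.app (Peri.mk m b) (fixPull E.Y g b c hc y) =
      fixPull E'.Y g b c hc (η.app (Peri.mk n c) y) := by
  -- Taking `r = 1` makes the structure map the identity, so only the pullback remains.
  have e : c = 1 * b * g.deg := by rw [hc, one_mul]
  have k := natTrans_map η (Peri.homMk (n := n) (m := m) g.cls 1 g.deg rfl e) y
  have k1 := h.map_homMk g 1 g.deg c rfl e hc (mul_one _).symm y
  have k2 := h'.map_homMk g 1 g.deg c rfl e hc (mul_one _).symm (η.app (Peri.mk n c) y)
  have p1 := k1.trans (congrArg (fixPull E.Y g b c hc) (E.phiMap_one (h := (mul_one c).symm) y))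
  have p2 := k2.trans (congrArg (fixPull E'.Y g b c hc) (E'.phiMap_one (h := (mul_one c).symm)
    (η.app (Peri.mk n c) y)))
  exact ((congrArg _ p1).symm.trans k).trans p2

/-- A natural transformation commutes with the structure maps. -/
theorem natTrans_phiMap (h : IsBeta E β) (h' : IsBeta E' β')
    (η : β.toFunctor ⟶ β'.toFunctor) (n : Cyc) (q c a : ℕ+) (hc : c = a * q)
    (y : (((sdFix c).obj E.Y).obj (op n)).X) :
    η.app (Peri.mk n a) (E.phiMap q c a hc n y) =
      E'.phiMap q c a hc n (η.app (Peri.mk n c) y) := by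
  have e : c = q * a * 1 := by rw [hc, mul_one, mul_comm]
  have k := natTrans_map η
    (Peri.homMk (n := n) (m := n) (PeriodicMap.id n.obj).cls q 1 rfl e) y
  have k1 := h.map_homMk (n := n) (m := n) (PeriodicMap.id n.obj) q 1 a rfl e
    (mul_one _).symm hc y
  have k2 := h'.map_homMk (n := n) (m := n) (PeriodicMap.id n.obj) q 1 a rfl e
    (mul_one _).symm hc (η.app (Peri.mk n c) y)
  have p1 := k1.trans (fixPull_id (h := (mul_one _).symm) _)
  have p2 := k2.trans (fixPull_id (h := (mul_one _).symm) _)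
  exact ((congrArg _ p1).symm.trans k).trans p2

/-- The component at `n` of the map of cyclic sets given by a natural transformation. -/
def natTransFun (η : β.toFunctor ⟶ β'.toFunctor) (n : Cyc) (y : (E.Y.obj (op n)).X) :
    (E'.Y.obj (op n)).X :=
  E'.Y.act (sameHom (per_sd_one n))
    (show (((sdFix 1).obj E'.Y).obj (op n)).X from
      η.app (Peri.mk n 1) (toFixOne E.Y n y)).1

theorem natTransFun_act (h : IsBeta E β) (h' : IsBeta E' β') (η : β.toFunctor ⟶ β'.toFunctor)
    {n m : Cyc} (f : PeriodicMap n.obj m.obj) (hf : f.deg = 1) (y : (E.Y.obj (op m)).X) :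
    natTransFun η n (E.Y.act (f.cyc hf) y) = E'.Y.act (f.cyc hf) (natTransFun η m y) := by
  have hc : (1 : ℕ+) = 1 * f.deg := by rw [hf, one_mul]
  have e : toFixOne E.Y n (E.Y.act (f.cyc hf) y) =
      fixPull E.Y f 1 1 hc (toFixOne E.Y m y) :=
    Subtype.ext (PCyc.act_cyc_eq E.Y (fun _ => by rfl) y)
  unfold natTransFun
  rw [e]
  refine (congrArg (fun t => E'.Y.act (sameHom (per_sd_one n))
    (show (((sdFix 1).obj E'.Y).obj (op n)).X from t).1)
    (natTrans_fixPull h h' η f 1 1 hc (toFixOne E.Y m y))).trans ?_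
  exact PCyc.act_cyc_eq E'.Y (fun _ => by rfl) _

/-- On `sd_a(Y)^{C_a}(n)` a natural transformation is given by its value at
`(a (n + 1) - 1, 1)`. -/
theorem natTransFun_fix (h : IsBeta E β) (h' : IsBeta E' β') (η : β.toFunctor ⟶ β'.toFunctor)
    (n : Cyc) (a : ℕ+) (y : (((sdFix a).obj E.Y).obj (op n)).X) :
    natTransFun η (sdObj a n) y.1 =
      (show (((sdFix a).obj E'.Y).obj (op n)).X from η.app (Peri.mk n a) y).1 := by
  -- This represents `Id_n^a`; pullback along it is the inclusion of fixed points, up to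
  -- `sd_1(Y)^{C_1} = Y`.
  let g : PeriodicMap (n.obj.sd a) n.obj :=
    { toFun := fun x => x, deg := a, mono := monotone_id, shift := fun x => by rw [per_sd] }
  have hc : a = 1 * g.deg := (one_mul a).symm
  have e : toFixOne E.Y (sdObj a n) y.1 = fixPull E.Y (m := sdObj a n) g 1 a hc y :=
    Subtype.ext (congrArg (fun t => E.Y.act t y.1) (cyc_eq ⟨0, fun x => by simp [g,
      PeriodicMap.sdDeg]⟩))
  unfold natTransFun
  rw [e]
  refine (congrArg (fun t => E'.Y.act (sameHom (per_sd_one (sdObj a n)))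
    (show (((sdFix 1).obj E'.Y).obj (op (sdObj a n))).X from t).1)
    (natTrans_fixPull h h' η (m := sdObj a n) g 1 a hc y)).trans ?_
  refine (E'.Y.act_act _ _ _).trans (E'.Y.act_id _ _)

/-- The map of epicyclic spaces given by a natural transformation. -/
def natTransMap (h : IsBeta E β) (h' : IsBeta E' β') (η : β.toFunctor ⟶ β'.toFunctor) :
    EpicyclicMap E E' where
  toFun := natTransFun η
  naturality {n m} f y := by
    obtain ⟨g, hg⟩ := Quotient.exists_rep f.hom
    have hd : g.deg = 1 := (congrArg Mod hg).trans f.property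
    obtain rfl : g.cyc hd = f := WideSubcategory.hom_ext _ hg
    exact natTransFun_act h h' η g hd y
  comm q n y := by
    -- Under `sd_1(Y)^{C_1} = Y`, the map `φ_q` is the value of `β` on `f_{q,1} : (n, q) → (n, 1)`.
    have e : toFixOne E.Y n (((E.φ q).app (op n)).toFun y) =
        E.phiMap q q 1 (one_mul q).symm n y := by
      refine Subtype.ext ?_
      refine (E.phiFix_sdAct q (n := sdObj 1 n) (m := n) _ rfl y.1 y.2).symm.trans ?_
      exact E.phiFix_congr rfl ((E.Y.act_id _ _).symm ▸ rfl) _ _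
    change E'.Y.act _ (show (((sdFix 1).obj E'.Y).obj (op n)).X from
      η.app (Peri.mk n 1) (toFixOne E.Y n _)).1 = _
    rw [e]
    refine (congrArg (fun t => E'.Y.act (sameHom (per_sd_one n))
      (show (((sdFix 1).obj E'.Y).obj (op n)).X from t).1)
      (natTrans_phiMap h h' η n q q 1 (one_mul q).symm y)).trans ?_
    refine (E'.phiFix_sdAct q (n := n) (m := sdObj 1 n) _ rfl _ _).symm.trans ?_
    refine E'.phiFix_congr rfl (Eq.trans ?_ (E'.Y.act_id _ _).symm) _ _
    refine Eq.trans ?_ (natTransFun_fix h h' η n q y).symm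
    exact (E'.Y.act_act _ _ _).trans (E'.Y.act_id _ _)

theorem natTransMap_onVal (h : IsBeta E β) (h' : IsBeta E' β')
    (η : β.toFunctor ⟶ β'.toFunctor) (X : Peri) (y : (E.val X).X) :
    η.app X y = (natTransMap h h' η).onVal X y :=
  Subtype.ext (natTransFun_fix h h' η X.n X.a y).symm

/-- The natural transformation given by a map of epicyclic spaces. -/
def EpicyclicMap.natTrans (g : EpicyclicMap E E') (h : IsBeta E β) (h' : IsBeta E' β') :
    β.toFunctor ⟶ β'.toFunctor where
  app X := ↾(g.onVal X)
  naturality X X' f := by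
    ext y
    exact g.onVal_map h h' f y

end

/-! ## Functors on `Π` which invert the morphisms `Id × f_{q,1}` -/

/-- `(Id_n, f_{q,1}) : (n, c) ⟶ (n, a)` for `c = q a`. -/
def Peri.resTo (n : Cyc) (q c a : ℕ+) (h : c = q * a) : Peri.mk n c ⟶ Peri.mk n a :=
  Peri.homMk (𝟙 n.obj) q 1 rfl (by simp [h])

theorem periW.resTo (n : Cyc) (q c a : ℕ+) (h : c = q * a) : periW (Peri.resTo n q c a h) := by
  subst h
  exact periW.mk n q a

/-- `(h, f_{1,u}) : (n, u) ⟶ (m, 1)` for `h : m ⟶ n` in `Λ̃` of degree `u`. -/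
def Peri.modHom {n m : EpiCat} (h : m ⟶ n) :
    Peri.mk ⟨n⟩ (Mod h) ⟶ Peri.mk ⟨m⟩ 1 :=
  Peri.homMk (n := ⟨n⟩) (m := ⟨m⟩) h 1 (Mod h) rfl (by simp)

theorem periProj_inverts : periW.IsInvertedBy periProj := by
  rintro _ _ _ ⟨n, q, a⟩
  exact inferInstanceAs (IsIso (𝟙 (op n.obj)))

section

variable {D : Type*} [Category D]

/-- Both functors send `f_{a,1} : (n, a) → (n, 1)` to an identity, so naturality equates the two
components. -/
theorem periProj_app_eq {G G' : EpiCatᵒᵖ ⥤ D} (η : periProj ⋙ G ⟶ periProj ⋙ G') (n : Cyc)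
    (a : ℕ+) : η.app (Peri.mk n a) = η.app (Peri.mk n 1) := by
  have h := η.naturality (Peri.resTo n a a 1 (mul_one a).symm)
  have e : ∀ G : EpiCatᵒᵖ ⥤ D, (periProj ⋙ G).map (Peri.resTo n a a 1 (mul_one a).symm) =
      𝟙 (G.obj (op n.obj)) := fun G => G.map_id _
  rw [e, e] at h
  exact ((Category.id_comp _).symm.trans (h.trans (Category.comp_id _))).symm

instance : ((Functor.whiskeringLeft Peri EpiCatᵒᵖ D).obj periProj).Faithful where
  map_injective {G G'} α α' h := by
    ext n
    exact congrArg (fun t => NatTrans.app t (Peri.mk ⟨n.unop⟩ 1)) h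

instance : ((Functor.whiskeringLeft Peri EpiCatᵒᵖ D).obj periProj).Full where
  map_surjective {G G'} η := by
    refine ⟨{ app := fun n => η.app (Peri.mk ⟨n.unop⟩ 1), naturality := fun n m h => ?_ }, ?_⟩
    -- Naturality along `h` is that of `η` along the lift of `h` starting at `(n, Mod h)`.
    · refine (η.naturality (Peri.modHom h.unop)).trans ?_
      rw [periProj_app_eq η ⟨n.unop⟩ (Mod h.unop)]
      rfl
    · ext X
      exact (periProj_app_eq η X.n X.a).symm

/-! ### Descent along `λ` by fractions -/

variable (F : Peri ⥤ D) (hF : periW.IsInvertedBy F)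

/-- The isomorphism `F(n, a) ≅ F(n, 1)`. -/
def resIso (n : Cyc) (a : ℕ+) : F.obj (Peri.mk n a) ≅ F.obj (Peri.mk n 1) :=
  haveI := hF _ (periW.resTo n a a 1 (mul_one a).symm)
  asIso (F.map (Peri.resTo n a a 1 (mul_one a).symm))

/-- A fraction is unchanged when its apex `(n, a)` is replaced by `(n, q a)`, because the `f_{q,1}`
compose multiplicatively. -/
theorem resIso_inv_map {n : Cyc} {X : Peri} {a c q : ℕ+} (h : c = q * a)
    (f : Peri.mk n a ⟶ X) :
    (resIso F hF n a).inv ≫ F.map f =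
      (resIso F hF n c).inv ≫ F.map (Peri.resTo n q c a h ≫ f) := by
  have e : (resIso F hF n c).hom =
      F.map (Peri.resTo n q c a h) ≫ (resIso F hF n a).hom := by
    refine Eq.trans ?_ (F.map_comp _ _)
    refine congrArg F.map (Peri.hom_ext (Category.id_comp _).symm ?_)
    change c = a * q
    rw [h, mul_comm]
  refine (Iso.eq_inv_comp _).mpr ?_
  rw [e, Category.assoc, Iso.hom_inv_id_assoc, F.map_comp]

/-- The map `F(n, 1) → F(m, 1)` induced by a morphism of `Λ̃`. -/
def descMap {n m : EpiCat} (h : m ⟶ n) :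
    F.obj (Peri.mk ⟨n⟩ 1) ⟶ F.obj (Peri.mk ⟨m⟩ 1) :=
  (resIso F hF ⟨n⟩ (Mod h)).inv ≫ F.map (Peri.modHom h)

/-- After passing to the apex `(n, a)`, both sides come from the one morphism `(n, a) → (m, 1)` with
component `Peri.epi f` in `Λ̃` and first index `Peri.r f * b`. -/
theorem map_resIso {n m : Cyc} {a b : ℕ+} (f : Peri.mk n a ⟶ Peri.mk m b) :
    F.map f ≫ (resIso F hF m b).hom =
      (resIso F hF n a).hom ≫ descMap F hF (Peri.epi f) := by
  have h : a = Peri.r f * b * Mod (Peri.epi f) := by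
    rw [Peri.Mod_epi]
    exact Peri.a_eq f
  refine Eq.trans ?_ (congrArg ((resIso F hF n a).hom ≫ ·)
    (resIso_inv_map F hF (n := n) h (Peri.modHom (Peri.epi f))).symm)
  refine Eq.trans ?_ (Iso.hom_inv_id_assoc _ _).symm
  refine (F.map_comp _ _).symm.trans (congrArg F.map (Peri.hom_ext ?_ ?_))
  · exact (Category.id_comp _).trans (Category.comp_id _).symm
  · exact (mul_comm _ _).trans (one_mul _).symm

theorem descMap_id (n : EpiCat) : descMap F hF (𝟙 n) = 𝟙 _ := by
  have h := map_resIso F hF (𝟙 (Peri.mk ⟨n⟩ 1))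
  rw [F.map_id, Category.id_comp] at h
  exact ((Iso.inv_comp_eq _).mpr (h.trans rfl)).symm.trans (Iso.inv_hom_id _) |>.symm ▸ rfl

theorem descMap_comp {n m p : EpiCat} (h : m ⟶ n) (h' : p ⟶ m) :
    descMap F hF (h' ≫ h) = descMap F hF h ≫ descMap F hF h' := by
  -- A lift of `h` ending at the apex of the fraction for `h'`, so that the two fractions can be
  -- composed.
  let f : Peri.mk ⟨n⟩ (Mod (h' ≫ h)) ⟶ Peri.mk ⟨m⟩ (Mod h') :=
    Peri.homMk (n := ⟨n⟩) (m := ⟨m⟩) h 1 (Mod h) rfl (by rw [Mod_comp, one_mul])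
  have e : Peri.modHom (h' ≫ h) = f ≫ Peri.modHom h' :=
    Peri.hom_ext rfl (one_mul 1).symm
  have k := (Iso.eq_inv_comp _).mpr (map_resIso F hF f).symm
  change descMap F hF h = _ at k
  unfold descMap at k ⊢
  rw [k, e, F.map_comp]
  have cancel : ∀ {A B C C' Z : D} (i : A ⟶ B) (j : B ⟶ C) (c : C ≅ C') (z : C ⟶ Z),
      i ≫ j ≫ z = (i ≫ j ≫ c.hom) ≫ c.inv ≫ z := by simp
  exact cancel _ _ (resIso F hF ⟨m⟩ (Mod h')) _

/-- The functor on `Λ̃ᵒᵖ` obtained from a functor on `Π` which inverts the morphisms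
`Id × f_{q,1}`. -/
def descFunctor : EpiCatᵒᵖ ⥤ D where
  obj n := F.obj (Peri.mk ⟨n.unop⟩ 1)
  map h := descMap F hF h.unop
  map_id n := descMap_id F hF n.unop
  map_comp h h' := descMap_comp F hF h.unop h'.unop

/-- The functor `descFunctor F hF` restricts to `F` along `λ`. -/
def descIso : periProj ⋙ descFunctor F hF ≅ F :=
  NatIso.ofComponents (fun X => (resIso F hF X.n X.a).symm) (fun {X X'} f => by
    have h := map_resIso F hF (n := X.n) (m := X'.n) (a := X.a) (b := X'.a) f
    exact ((Iso.inv_comp_eq _).mpr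
      (((Iso.eq_comp_inv _).mpr h).trans (Category.assoc _ _ _))).symm)

theorem essImage_whiskeringLeft_periProj (F : Peri ⥤ D) :
    ((Functor.whiskeringLeft Peri EpiCatᵒᵖ D).obj periProj).essImage F ↔
      periW.IsInvertedBy F := by
  refine ⟨fun ⟨G, ⟨e⟩⟩ => ?_, fun hF => ⟨descFunctor F hF, ⟨descIso F hF⟩⟩⟩
  exact (MorphismProperty.IsInvertedBy.iff_of_iso _ e).mp
    (MorphismProperty.IsInvertedBy.of_comp _ _ periProj_inverts G)

end

end

end Pericyclic

/-! ### Assembly of the theorem -/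

theorem mainTheorem2 :
    -- the equalities define a unique functor `β : Π ⥤ Sets`
    (∀ E : EpicyclicSpace.{u},
      ∃! β : FunctorOn (fun X : Peri => (E.val X).X), IsBeta E β) ∧
    -- its maps preserve the base points
    (∀ (E : EpicyclicSpace.{u}) (β : FunctorOn (fun X : Peri => (E.val X).X)), IsBeta E β →
      ∀ {X X' : Peri} (f : X ⟶ X'), β.map f (E.val X).point = (E.val X').point) ∧
    -- `β` encodes `(Y, φ)` faithfully
    (∀ (E E' : EpicyclicSpace.{u}) (β : FunctorOn (fun X : Peri => (E.val X).X))
      (β' : FunctorOn (fun X : Peri => (E'.val X).X)), IsBeta E β → IsBeta E' β' →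
        (∀ g : EpicyclicMap E E', ∃ η : β.toFunctor ⟶ β'.toFunctor,
          ∀ (X : Peri) (y : (E.val X).X), η.app X y = g.onVal X y) ∧
        (∀ η : β.toFunctor ⟶ β'.toFunctor, ∃! g : EpicyclicMap E E',
          ∀ (X : Peri) (y : (E.val X).X), η.app X y = g.onVal X y) ∧
        (∀ g : EpicyclicMap E E',
          g.IsPointed ↔ ∀ X : Peri, g.onVal X (E.val X).point = (E'.val X).point)) ∧
    -- the functors `Λ̃ᵒᵖ ⥤ Sets` are the functors `Π ⥤ Sets` which invert `W`
    (((Functor.whiskeringLeft Peri EpiCatᵒᵖ (Type u)).obj periProj).Full ∧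
      ((Functor.whiskeringLeft Peri EpiCatᵒᵖ (Type u)).obj periProj).Faithful ∧
      ∀ F : Peri ⥤ Type u,
        ((Functor.whiskeringLeft Peri EpiCatᵒᵖ (Type u)).obj periProj).essImage F ↔
          periW.IsInvertedBy F) := by
  refine ⟨fun E => ⟨E.beta, E.isBeta_beta, fun β h => h.eq E.isBeta_beta⟩,
    fun E β h {X X'} f => h.map_point f, fun E E' β β' h h' => ⟨fun g => ?_, fun η => ?_, ?_⟩,
    inferInstance, inferInstance, essImage_whiskeringLeft_periProj⟩
  · exact ⟨g.natTrans h h', fun X y => rfl⟩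
  · refine ⟨natTransMap h h' η, natTransMap_onVal h h' η, fun g hg => ?_⟩
    exact EpicyclicMap.ext_onVal fun X y => (hg X y).symm.trans (natTransMap_onVal h h' η X y)
  · exact EpicyclicMap.isPointed_iff
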